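/- Let $H$ be a locally compact CAT($-1$) space with geodesic boundary $\partial H$ (asymptote classes of geodesic rays), and suppose that $H$ has extendible geodesics: any two distinct points of $H$ lie on a bi-infinite geodesic. Let a group $G$ act on $H$ by isometries and cocompactly, i.e. the $G$-translates of some compact subset cover $H$. For $p\in H$ and $\xi,\eta\in\partial H$ let $(\xi\cdot\eta)_p\in[0,\infty]$ be the Gromov product, i.e. the limit as $s,t\to\infty$ of $(x_s\cdot y_t)_p=\frac12\big(d(x_s,p)+d(y_t,p)-d(x_s,y_t)\big)$, where $x_s$, $y_t$ are the points at distance $s$, $t$ from $p$ on the geodesic rays from $p$ to $\xi$, $\eta$. Suppose there is a $K<-1$ such that for every triangle with one vertex $p\in H$ and two distinct vertices $\xi,\eta\in\partial H$ at least one of the following holds: 1. the rays from $p$ to $\xi$ and from $p$ to $\eta$ have a common nontrivial initial segment; 2. the triangle is fatter than its comparison triangle in the plane $\mathbb{H}^2_K$ of constant curvature $K$: if $\bar p\in\mathbb{H}^2_K$ and $\bar\xi,\bar\eta\in\partial\mathbb{H}^2_K$ satisfy $(\bar\xi\cdot\bar\eta)_{\bar p}=(\xi\cdot\eta)_p$,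 and $\bar x_s$, $\bar y_t$ denote the points at distance $s$, $t$ from $\bar p$ on the rays from $\bar p$ to $\bar\xi$, $\bar\eta$, then $d(x_s,y_t)\ge d(\bar x_s,\bar y_t)$ for all $s,t\ge 0$. Then $H$ has bounded flip: there are constants $R_1,R_2>0$ such that for all $\zeta,\nu\in\partial H$ and all $p\in H$ there exist bi-infinite unit speed geodesics $\gamma_1,\gamma_2$ in $H$ with $\gamma_1(0)=\gamma_2(0)=p$, with forward endpoints $\gamma_1^+=\zeta$, $\gamma_2^+=\nu$, and with backward endpoints satisfying $$(\gamma_1^-\cdot\gamma_2^-)_p\ \ge\ R_1\,(\gamma_1^+\cdot\gamma_2^+)_p-R_2 .$$ -/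

import Mathlib

open Filter Topology
open scoped NNReal

/-- The plane of constant curvature `K < 0`: the hyperbolic plane (Mathlib's upper half-plane,
whose metric has curvature `-1`) with its metric divided by `√(-K)`. -/
def HypPlane (_K : Set.Iio (0 : ℝ)) : Type := UpperHalfPlane

namespace HypPlane

/-- The underlying point of the upper half-plane. -/
def toUpper {K : Set.Iio (0 : ℝ)} (z : HypPlane K) : UpperHalfPlane := z

theorem sqrt_neg_pos (K : Set.Iio (0 : ℝ)) : 0 < Real.sqrt (-(K : ℝ)) :=
  Real.sqrt_pos.mpr (neg_pos.mpr K.2)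

noncomputable instance (K : Set.Iio (0 : ℝ)) : MetricSpace (HypPlane K) where
  dist z w := dist z.toUpper w.toUpper / Real.sqrt (-(K : ℝ))
  dist_self z := by simp
  dist_comm z w := by rw [dist_comm]
  dist_triangle x y z := by
    rw [← add_div]
    exact div_le_div_of_nonneg_right (dist_triangle _ _ _) (sqrt_neg_pos K).le
  eq_of_dist_eq_zero {x y} h := by
    rcases div_eq_zero_iff.mp h with h | h
    · exact (dist_eq_zero (γ := UpperHalfPlane)).mp h
    · exact absurd h (sqrt_neg_pos K).ne'

end HypPlane

/-- Any two points are joined by a geodesic segment. -/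
def IsGeodesicSpace (X : Type*) [MetricSpace X] : Prop :=
  ∀ x y : X, ∃ c : ℝ → X, c 0 = x ∧ c (dist x y) = y ∧
    ∀ s ∈ Set.Icc 0 (dist x y), ∀ t ∈ Set.Icc 0 (dist x y), dist (c s) (c t) = |s - t|

/-- `X` is a CAT(`K`) space, `K < 0`: it is a geodesic space, and every geodesic triangle
`x, y, z` has a comparison triangle `x', y', z'` in the plane of curvature `K` such that distances
between points of two sides are at most the distances between the comparison points. (In a
geodesic space, `p` lies on a geodesic segment from `x` to `y` if and only if
`dist x p + dist p y = dist x y`.) -/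
def IsCAT (K : Set.Iio (0 : ℝ)) (X : Type*) [MetricSpace X] : Prop :=
  IsGeodesicSpace X ∧
  ∀ x y z : X, ∃ x' y' z' : HypPlane K,
    dist x' y' = dist x y ∧ dist x' z' = dist x z ∧ dist y' z' = dist y z ∧
    ∀ (p q : X) (p' q' : HypPlane K),
      dist x p + dist p y = dist x y → dist x q + dist q z = dist x z →
      dist x' p' = dist x p → dist p' y' = dist p y →
      dist x' q' = dist x q → dist q' z' = dist q z →
      dist p q ≤ dist p' q'

/-- The CAT(-1) condition. -/
def IsCATNegOne (X : Type*) [MetricSpace X] : Prop :=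
  IsCAT ⟨-1, by norm_num⟩ X

/-- Unit speed geodesic rays. -/
structure GeodesicRay (X : Type*) [MetricSpace X] where
  toFun : ℝ≥0 → X
  isometry : Isometry toFun

/-- Bi-infinite unit speed geodesics. -/
structure GeodesicLine (X : Type*) [MetricSpace X] where
  toFun : ℝ → X
  isometry : Isometry toFun

instance (X : Type*) [MetricSpace X] : CoeFun (GeodesicRay X) (fun _ => ℝ≥0 → X) :=
  ⟨GeodesicRay.toFun⟩

instance (X : Type*) [MetricSpace X] : CoeFun (GeodesicLine X) (fun _ => ℝ → X) :=
  ⟨GeodesicLine.toFun⟩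

/-- Two rays are asymptotic if they stay at bounded distance from each other. -/
instance asymptoticSetoid (X : Type*) [MetricSpace X] : Setoid (GeodesicRay X) where
  r f g := ∃ C : ℝ, ∀ t, dist (f t) (g t) ≤ C
  iseqv :=
    { refl := fun _ => ⟨0, fun _ => by simp⟩
      symm := fun ⟨C, h⟩ => ⟨C, fun t => by rw [dist_comm]; exact h t⟩
      trans := fun ⟨C, h⟩ ⟨D, k⟩ =>
        ⟨C + D, fun t => (dist_triangle _ _ _).trans (add_le_add (h t) (k t))⟩ }

/-- The geodesic boundary `∂X`: asymptote classes of geodesic rays. -/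
def IdealBoundary (X : Type*) [MetricSpace X] : Type _ := Quotient (asymptoticSetoid X)

/-- The endpoint at infinity of a ray. -/
def GeodesicRay.endpoint {X : Type*} [MetricSpace X] (f : GeodesicRay X) : IdealBoundary X :=
  Quotient.mk (asymptoticSetoid X) f

namespace GeodesicLine

variable {X : Type*} [MetricSpace X]

/-- The ray `t ↦ γ t`, `t ≥ 0`. -/
def forward (γ : GeodesicLine X) : GeodesicRay X where
  toFun t := γ (t : ℝ)
  isometry := γ.isometry.comp isometry_subtype_coe

/-- The ray `t ↦ γ (-t)`, `t ≥ 0`. -/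
def backward (γ : GeodesicLine X) : GeodesicRay X where
  toFun t := γ (-(t : ℝ))
  isometry := γ.isometry.comp ((IsometryEquiv.neg ℝ).isometry.comp isometry_subtype_coe)

end GeodesicLine

/-- The Gromov product `(x · y)_p`. -/
noncomputable def gromovProduct {X : Type*} [MetricSpace X] (p x y : X) : ℝ :=
  (dist x p + dist y p - dist x y) / 2

/-- The Gromov product `(ξ · η)_p ∈ [0, ∞]` of the endpoints at infinity of two rays `f`, `g`
that issue from the same point `p`: the limit of `(f s · g t)_p` as `s, t → ∞`. (This quantity is
nondecreasing in `s` and `t`, so that the lower limit is a limit.) -/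
noncomputable def rayGromovProduct {X : Type*} [MetricSpace X] (f g : GeodesicRay X) : EReal :=
  liminf (fun r : ℝ≥0 × ℝ≥0 => ((gromovProduct (f 0) (f r.1) (g r.2) : ℝ) : EReal)) atTop

/-- Every pair of distinct points lies on a bi-infinite geodesic. -/
def HasGeodesicExtension (X : Type*) [MetricSpace X] : Prop :=
  ∀ p q : X, p ≠ q → ∃ γ : GeodesicLine X, γ 0 = p ∧ γ (dist p q) = q

/-- The action of `G` on `X` is cocompact: the translates of some compact set cover `X`. -/
def ActsCocompactly (G X : Type*) [Group G] [MetricSpace X] [MulAction G X] : Prop :=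
  ∃ C : Set X, IsCompact C ∧ ∀ x : X, ∃ g : G, ∃ y ∈ C, g • y = x

/-- The two sides `f`, `g` of a triangle with interior vertex `f 0 = g 0` meet that vertex along
a common nontrivial segment. -/
def ShareInitialSegment {X : Type*} [MetricSpace X] (f g : GeodesicRay X) : Prop :=
  ∃ ε : ℝ≥0, 0 < ε ∧ ∀ t ≤ ε, f t = g t

/-- The triangle with interior vertex `f 0 = g 0` and ideal vertices the endpoints of `f` and `g`
is fatter than its comparison triangle in the plane of curvature `K`. The comparison triangle has
one interior and two ideal vertices, with the same Gromov product of the ideal vertices seen from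
the interior one (the only isometry invariant of such a triangle in the plane), and points on the
two sides at the interior vertex are at least as far apart as their comparison points. -/
def FatterThanComparison (K : Set.Iio (0 : ℝ)) {X : Type*} [MetricSpace X]
    (f g : GeodesicRay X) : Prop :=
  ∃ f' g' : GeodesicRay (HypPlane K), f' 0 = g' 0 ∧
    rayGromovProduct f' g' = rayGromovProduct f g ∧
    ∀ s t : ℝ≥0, dist (f' s) (g' t) ≤ dist (f s) (g t)

/-- Bounded flip. -/
def HasBoundedFlip (X : Type*) [MetricSpace X] : Prop :=
  ∃ R₁ R₂ : ℝ, 0 < R₁ ∧ 0 < R₂ ∧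
    ∀ (ζ ν : IdealBoundary X) (p : X), ∃ γ₁ γ₂ : GeodesicLine X,
      γ₁.forward.endpoint = ζ ∧ γ₂.forward.endpoint = ν ∧ γ₁ 0 = p ∧ γ₂ 0 = p ∧
      rayGromovProduct γ₁.backward γ₂.backward ≥
        (R₁ : EReal) * rayGromovProduct γ₁.forward γ₂.forward - (R₂ : EReal)

/-!
Two lines `γ₁`, `γ₂` through `p` whose forward product at `p` is `A` are `O(ℓ e^{-κ₀ A})`-close at
time `ℓ ≤ 1`, where the space is CAT(`-κ₀²`). Take `ℓ` with `0 < ℓ ≤ 1` and let `h` be the ray from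
`γ₂ ℓ` to `γ₁⁻`. It passes `p` at distance at most `dist (γ₁ ℓ) (γ₂ ℓ)`, so if the triangle with
vertices `γ₂ ℓ`, `γ₁⁻`, `γ₂⁻` is fatter than its comparison triangle in the plane of curvature
`K = -κ²`, then so close a pair of rays in that plane must have product at least
`(κ₀ / κ) A - O(1)`, and moving the base point from `γ₂ ℓ` to `p` costs at most `ℓ`.

The triangle is known to be fat only if its sides at `γ₂ ℓ` separate at once. Follow the ray from
`γ₂ 1` to `γ₁⁻` while it coincides with `γ₂` run backwards. If they separate before `p`, start at
the point `γ₂ ℓ` of separation. Otherwise the rays from `p` to `γ₂⁺` and to `γ₁⁻` leave `p` in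
opposite directions, hence form a line, which replaces `γ₂` and makes the backward product infinite.
-/

section HyperbolicPlane

open Real

theorem cosh_sub_cosh (x y : ℝ) :
    cosh x - cosh y = 2 * sinh ((x + y) / 2) * sinh ((x - y) / 2) := by
  have hx := cosh_add ((x + y) / 2) ((x - y) / 2)
  have hy := cosh_sub ((x + y) / 2) ((x - y) / 2)
  rw [show (x + y) / 2 + (x - y) / 2 = x by ring] at hx
  rw [show (x + y) / 2 - (x - y) / 2 = y by ring] at hy
  rw [hx, hy]
  ring

theorem cosh_sub_one (x : ℝ) : cosh x - 1 = 2 * sinh (x / 2) ^ 2 := by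
  have h := cosh_sub_cosh x 0
  rw [cosh_zero, add_zero, sub_zero] at h
  rw [h]
  ring

theorem sinh_add_sq (x y : ℝ) :
    sinh (x + y) ^ 2 = sinh x ^ 2 + sinh y ^ 2 + 2 * sinh x * sinh y * cosh (x + y) := by
  rw [sinh_add, cosh_add]
  linear_combination sinh x ^ 2 * cosh_sq y + sinh y ^ 2 * cosh_sq x

theorem sinh_sub_le_exp_mul_sinh (x : ℝ) {y : ℝ} (hy : 0 ≤ y) :
    sinh (x - y) ≤ exp (-y) * sinh x := by
  have h : exp (-y - x) ≤ exp (y - x) := exp_le_exp.mpr (by linarith)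
  rw [sinh_eq, sinh_eq, mul_div_assoc', mul_sub, ← exp_add, ← exp_add, neg_sub,
    show -y + x = x - y by ring, show -y + -x = -y - x by ring]
  linarith

/-- The Minkowski form of signature `(1, 2)` on `ℝ³` in light cone coordinates. Its unit vectors
with positive second coordinate are the hyperboloid model of the hyperbolic plane. -/
noncomputable def minkowskiForm : LinearMap.BilinForm ℝ (ℝ × ℝ × ℝ) :=
  LinearMap.mk₂ ℝ (fun v w => (v.2.1 * w.2.2 + v.2.2 * w.2.1) / 2 - v.1 * w.1)
    (fun _ _ _ => by simp only [Prod.fst_add, Prod.snd_add]; ring)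
    (fun _ _ _ => by simp only [Prod.smul_fst, Prod.smul_snd, smul_eq_mul]; ring)
    (fun _ _ _ => by simp only [Prod.fst_add, Prod.snd_add]; ring)
    (fun _ _ _ => by simp only [Prod.smul_fst, Prod.smul_snd, smul_eq_mul]; ring)

theorem minkowskiForm_apply (v w : ℝ × ℝ × ℝ) :
    minkowskiForm v w = (v.2.1 * w.2.2 + v.2.2 * w.2.1) / 2 - v.1 * w.1 :=
  rfl

theorem minkowskiForm_comm (v w : ℝ × ℝ × ℝ) : minkowskiForm v w = minkowskiForm w v := by
  simp only [minkowskiForm_apply]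
  ring

theorem eq_zero_of_minkowskiForm_eq_zero {v o : ℝ × ℝ × ℝ} (ho : minkowskiForm o o = 1)
    (hv : minkowskiForm v v = 0) (hvo : minkowskiForm v o = 0) : v = 0 := by
  obtain ⟨v₁, v₂, v₃⟩ := v
  obtain ⟨o₁, o₂, o₃⟩ := o
  simp only [minkowskiForm_apply] at ho hv hvo
  have hsq : (v₂ * o₃ - v₃ * o₂) ^ 2 + 4 * v₁ ^ 2 = 0 := by
    linear_combination (2 * (v₂ * o₃ + v₃ * o₂) + 4 * v₁ * o₁) * hvo - 4 * o₂ * o₃ * hv -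
      4 * v₁ ^ 2 * ho
  obtain rfl : v₁ = 0 := by nlinarith [sq_nonneg (v₂ * o₃ - v₃ * o₂), sq_nonneg v₁]
  have hcross : v₂ * o₃ - v₃ * o₂ = 0 := by nlinarith [sq_nonneg (v₂ * o₃ - v₃ * o₂)]
  have h₂ : v₂ * o₃ = 0 := by linarith
  have h₃ : v₃ * o₂ = 0 := by linarith
  have ho₂ : o₂ ≠ 0 := by rintro rfl; nlinarith [sq_nonneg o₁]
  have ho₃ : o₃ ≠ 0 := by rintro rfl; nlinarith [sq_nonneg o₁]
  simp_all

theorem sinh_smul_eq_of_minkowskiForm {o m x : ℝ × ℝ × ℝ} {s r : ℝ}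
    (ho : minkowskiForm o o = 1) (hm : minkowskiForm m m = 1) (hx : minkowskiForm x x = 1)
    (hom : minkowskiForm o m = cosh s) (hmx : minkowskiForm m x = cosh r)
    (hox : minkowskiForm o x = cosh (s + r)) :
    sinh (s + r) • m = sinh r • o + sinh s • x := by
  have hr : sinh r = sinh (s + r) * cosh s - cosh (s + r) * sinh s := by
    rw [← sinh_sub, add_sub_cancel_left]
  refine sub_eq_zero.mp (eq_zero_of_minkowskiForm_eq_zero ho ?_ ?_)
  · simp only [map_sub, map_add, map_smul, LinearMap.sub_apply, LinearMap.add_apply,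
      LinearMap.smul_apply, smul_eq_mul, minkowskiForm_comm m o, minkowskiForm_comm x, ho, hm, hx,
      hom, hmx, hox]
    linear_combination -sinh_add_sq s r + 2 * sinh (s + r) * sinh_add s r
  · simp only [map_sub, map_add, map_smul, LinearMap.sub_apply, LinearMap.add_apply,
      LinearMap.smul_apply, smul_eq_mul, minkowskiForm_comm _ o, ho, hom, hox]
    linear_combination -hr

/-- The point that divides the segment `ox` of length `s + r` of the hyperboloid at distance `s`
from `o`. -/
noncomputable def hyperboloidCombination (s r : ℝ) (o x : ℝ × ℝ × ℝ) : ℝ × ℝ × ℝ :=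
  (sinh (s + r))⁻¹ • (sinh r • o + sinh s • x)

theorem minkowskiForm_hyperboloidCombination {o x : ℝ × ℝ × ℝ} {s r : ℝ} (hsr : 0 < s + r)
    (ho : minkowskiForm o o = 1) (hx : minkowskiForm x x = 1)
    (hox : minkowskiForm o x = cosh (s + r)) :
    minkowskiForm (hyperboloidCombination s r o x) (hyperboloidCombination s r o x) = 1 ∧
      minkowskiForm o (hyperboloidCombination s r o x) = cosh s ∧
      minkowskiForm (hyperboloidCombination s r o x) x = cosh r := by
  have hsinh := (sinh_pos_iff.mpr hsr).ne'
  have hr := sinh_sub (s + r) s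
  have hs := sinh_sub (s + r) r
  rw [add_sub_cancel_left] at hr
  rw [add_sub_cancel_right] at hs
  simp only [hyperboloidCombination, map_add, map_smul, LinearMap.add_apply, LinearMap.smul_apply,
    smul_eq_mul, minkowskiForm_comm x o, ho, hx, hox]
  refine ⟨?_, ?_, ?_⟩ <;> field_simp
  · linear_combination -sinh_add_sq s r
  · linear_combination hr
  · linear_combination hs

/-- The factor `√(-K)` that turns distances in the plane of curvature `K` into distances in the
plane of curvature `-1`. -/
noncomputable def curvatureScale (K : Set.Iio (0 : ℝ)) : ℝ :=
  √(-(K : ℝ))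

theorem curvatureScale_pos (K : Set.Iio (0 : ℝ)) : 0 < curvatureScale K :=
  HypPlane.sqrt_neg_pos K

namespace HypPlane

variable {K : Set.Iio (0 : ℝ)}

local notation "κ" => curvatureScale K

theorem curvatureScale_mul_dist (z w : HypPlane K) : κ * dist z w = dist z.toUpper w.toUpper :=
  mul_div_cancel₀ _ (sqrt_neg_pos K).ne'

/-- The point of the hyperboloid corresponding to a point of the upper half-plane. -/
noncomputable def lift (z : HypPlane K) : ℝ × ℝ × ℝ :=
  (z.toUpper.re / z.toUpper.im, 1 / z.toUpper.im,
    (z.toUpper.re ^ 2 + z.toUpper.im ^ 2) / z.toUpper.im)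

theorem lift_snd_fst_pos (z : HypPlane K) : 0 < z.lift.2.1 :=
  one_div_pos.mpr z.toUpper.im_pos

theorem minkowskiForm_lift (z w : HypPlane K) :
    minkowskiForm z.lift w.lift = cosh (κ * dist z w) := by
  have hz := z.toUpper.im_pos.ne'
  have hw := w.toUpper.im_pos.ne'
  rw [curvatureScale_mul_dist, UpperHalfPlane.cosh_dist, Complex.dist_eq, Complex.sq_norm,
    Complex.normSq_apply]
  simp only [minkowskiForm_apply, lift, Complex.sub_re, Complex.sub_im, UpperHalfPlane.coe_re,
    UpperHalfPlane.coe_im]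
  field_simp
  ring

theorem minkowskiForm_lift_self (z : HypPlane K) : minkowskiForm z.lift z.lift = 1 := by
  rw [minkowskiForm_lift, dist_self, mul_zero, cosh_zero]

theorem exists_lift_eq {v : ℝ × ℝ × ℝ} (hv : minkowskiForm v v = 1) (hpos : 0 < v.2.1) :
    ∃ z : HypPlane K, z.lift = v := by
  obtain ⟨v₁, v₂, v₃⟩ := v
  simp only [minkowskiForm_apply] at hv hpos
  have h₂ := hpos.ne'
  refine ⟨(⟨⟨v₁ / v₂, 1 / v₂⟩, by simpa using hpos⟩ : UpperHalfPlane), ?_⟩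
  simp only [lift, toUpper, UpperHalfPlane.re, UpperHalfPlane.im, Prod.mk.injEq]
  refine ⟨by field_simp, by field_simp, ?_⟩
  field_simp
  linarith

theorem dist_eq_of_minkowskiForm_lift {z w : HypPlane K} {t : ℝ} (ht : 0 ≤ t)
    (h : minkowskiForm z.lift w.lift = cosh (κ * t)) : dist z w = t := by
  have hκ := curvatureScale_pos K
  rw [minkowskiForm_lift] at h
  exact mul_left_cancel₀ hκ.ne' (cosh_strictMonoOn.injOn
    (Set.mem_Ici.mpr (mul_nonneg hκ.le dist_nonneg)) (Set.mem_Ici.mpr (mul_nonneg hκ.le ht)) h)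

theorem stewart {o m x : HypPlane K} (h : dist o m + dist m x = dist o x) (w : HypPlane K) :
    sinh (κ * dist o x) * cosh (κ * dist m w) =
      sinh (κ * dist m x) * cosh (κ * dist o w) + sinh (κ * dist o m) * cosh (κ * dist x w) := by
  have hlift := sinh_smul_eq_of_minkowskiForm o.minkowskiForm_lift_self m.minkowskiForm_lift_self
    x.minkowskiForm_lift_self (o.minkowskiForm_lift m) (m.minkowskiForm_lift x)
    (by rw [o.minkowskiForm_lift, ← h, mul_add])
  simpa only [map_add, map_smul, LinearMap.add_apply, LinearMap.smul_apply, smul_eq_mul,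
    minkowskiForm_lift, ← mul_add, h] using congrArg (minkowskiForm · w.lift) hlift

theorem exists_dist_eq_dist_eq (o x : HypPlane K) {s r : ℝ} (hs : 0 ≤ s) (hr : 0 ≤ r)
    (h : s + r = dist o x) : ∃ m : HypPlane K, dist o m = s ∧ dist m x = r := by
  have hκ := curvatureScale_pos K
  rcases (add_nonneg hs hr).eq_or_lt with hzero | hadd
  · exact ⟨o, by rw [dist_self]; linarith, by linarith⟩
  have hpos : 0 < κ * s + κ * r := by rw [← mul_add]; positivity
  obtain ⟨hself, hom, hmx⟩ := minkowskiForm_hyperboloidCombination hpos o.minkowskiForm_lift_self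
    x.minkowskiForm_lift_self (by rw [minkowskiForm_lift, ← h, mul_add])
  have hfuture : 0 < (hyperboloidCombination (κ * s) (κ * r) o.lift x.lift).2.1 := by
    have ho := o.lift_snd_fst_pos
    have hx := x.lift_snd_fst_pos
    simp only [hyperboloidCombination, Prod.smul_fst, Prod.smul_snd, Prod.fst_add, Prod.snd_add,
      smul_eq_mul]
    refine mul_pos (inv_pos.mpr (sinh_pos_iff.mpr hpos)) ?_
    rcases hs.eq_or_lt with rfl | hs
    · rw [zero_add] at hadd
      positivity
    · positivity
  obtain ⟨m, hm⟩ := exists_lift_eq (K := K) hself hfuture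
  rw [← hm] at hom hmx
  exact ⟨m, dist_eq_of_minkowskiForm_lift hs hom, dist_eq_of_minkowskiForm_lift hr hmx⟩

end HypPlane

end HyperbolicPlane

section Comparison

open Real

variable {X : Type*} [MetricSpace X]

/-- `sin² (θ / 2)`, where `θ` is the angle at `o` of the comparison triangle of `o`, `x`, `y` in the
plane of curvature `-κ²`, as computed by the law of cosines. It is `0` if `o` is `x` or `y`. -/
noncomputable def comparisonHaversine (κ : ℝ) (o x y : X) : ℝ :=
  (cosh (κ * dist x y) - cosh (κ * (dist o x - dist o y))) /
    (2 * sinh (κ * dist o x) * sinh (κ * dist o y))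

theorem comparisonHaversine_comm (κ : ℝ) (o x y : X) :
    comparisonHaversine κ o x y = comparisonHaversine κ o y x := by
  rw [comparisonHaversine, comparisonHaversine, dist_comm x y, ← cosh_neg (κ * (dist o x - _)),
    ← mul_neg, neg_sub, mul_right_comm]

theorem cosh_mul_dist_eq {κ : ℝ} (hκ : 0 < κ) (o x y : X) :
    cosh (κ * dist x y) = cosh (κ * (dist o x - dist o y)) +
      2 * sinh (κ * dist o x) * sinh (κ * dist o y) * comparisonHaversine κ o x y := by
  rcases eq_or_ne o x with rfl | hx
  · simp
  rcases eq_or_ne o y with rfl | hy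
  · simp [dist_comm]
  have := dist_pos.mpr hx
  have := dist_pos.mpr hy
  rw [comparisonHaversine, mul_div_cancel₀ _ (by positivity)]
  ring

theorem comparisonHaversine_nonneg {κ : ℝ} (hκ : 0 < κ) (o x y : X) :
    0 ≤ comparisonHaversine κ o x y := by
  have hcosh : cosh (κ * (dist o x - dist o y)) ≤ cosh (κ * dist x y) := by
    rw [cosh_le_cosh, abs_mul, abs_mul, abs_of_nonneg (dist_nonneg (x := x))]
    gcongr
    simpa only [dist_comm o] using abs_dist_sub_le x y o
  exact div_nonneg (sub_nonneg.mpr hcosh) (by positivity)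

theorem sinh_half_dist_sq {κ : ℝ} (hκ : 0 < κ) {o x y : X} (h : dist o x = dist o y) :
    sinh (κ * dist x y / 2) ^ 2 = sinh (κ * dist o x) ^ 2 * comparisonHaversine κ o x y := by
  have hcosh := cosh_mul_dist_eq hκ o x y
  rw [h, sub_self, mul_zero, cosh_zero] at hcosh
  rw [h]
  linear_combination hcosh / 2 - cosh_sub_one (κ * dist x y) / 2

theorem gromovProduct_nonneg (p x y : X) : 0 ≤ gromovProduct p x y := by
  have := dist_triangle_right x y p
  rw [gromovProduct]
  linarith

theorem comparisonHaversine_le_exp {κ : ℝ} (hκ : 0 < κ) (o x y : X) :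
    comparisonHaversine κ o x y ≤ exp (-(κ * gromovProduct o x y)) ^ 2 := by
  rcases eq_or_ne o x with rfl | hx
  · simpa [comparisonHaversine] using sq_nonneg _
  rcases eq_or_ne o y with rfl | hy
  · simpa [comparisonHaversine] using sq_nonneg _
  have := dist_pos.mpr hx
  have := dist_pos.mpr hy
  have hP : 0 ≤ κ * gromovProduct o x y := mul_nonneg hκ.le (gromovProduct_nonneg o x y)
  rw [comparisonHaversine, div_le_iff₀ (by positivity), cosh_sub_cosh]
  have hsum : (κ * dist x y + κ * (dist o x - dist o y)) / 2 =
      κ * dist o x - κ * gromovProduct o x y := by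
    rw [gromovProduct, dist_comm x o, dist_comm y o]; ring
  have hdiff : (κ * dist x y - κ * (dist o x - dist o y)) / 2 =
      κ * dist o y - κ * gromovProduct o x y := by
    rw [gromovProduct, dist_comm x o, dist_comm y o]; ring
  have hdiff_nonneg : 0 ≤ sinh ((κ * dist x y - κ * (dist o x - dist o y)) / 2) := by
    rw [sinh_nonneg_iff, ← mul_sub]
    have := dist_triangle o y x
    rw [dist_comm y x] at this
    exact div_nonneg (mul_nonneg hκ.le (by linarith)) zero_le_two
  calc
    _ ≤ 2 * (exp (-(κ * gromovProduct o x y)) * sinh (κ * dist o x)) *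
        (exp (-(κ * gromovProduct o x y)) * sinh (κ * dist o y)) := by
      rw [hdiff] at hdiff_nonneg ⊢
      rw [hsum]
      gcongr
      · exact sinh_sub_le_exp_mul_sinh _ hP
      · exact sinh_sub_le_exp_mul_sinh _ hP
    _ = _ := by ring

theorem HypPlane.comparisonHaversine_eq_of_between {K : Set.Iio (0 : ℝ)} {o m x : HypPlane K}
    (hm : m ≠ o) (h : dist o m + dist m x = dist o x) (y : HypPlane K) :
    comparisonHaversine (curvatureScale K) o m y =
      comparisonHaversine (curvatureScale K) o x y := by
  have hκ := curvatureScale_pos K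
  have hstewart := stewart h y
  set κ := curvatureScale K
  rcases eq_or_ne o y with rfl | hy
  · simp [comparisonHaversine]
  have hom := dist_pos.mpr hm.symm
  have hoy := dist_pos.mpr hy
  have hox : 0 < dist o x := by linarith [dist_nonneg (x := m) (y := x)]
  have hcollinear : sinh (κ * dist m x) * cosh (κ * dist o y) +
      sinh (κ * dist o m) * cosh (κ * (dist o x - dist o y)) =
      sinh (κ * dist o x) * cosh (κ * (dist o m - dist o y)) := by
    rw [← h, show κ * (dist o m + dist m x - dist o y) =
      κ * dist o m + κ * dist m x - κ * dist o y by ring, mul_add, mul_sub]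
    simp only [cosh_sub, cosh_add, sinh_add]
    linear_combination -sinh (κ * dist m x) * cosh (κ * dist o y) * cosh_sq (κ * dist o m)
  rw [comparisonHaversine, comparisonHaversine, div_eq_div_iff (by positivity) (by positivity)]
  linear_combination 2 * sinh (κ * dist o y) * (hstewart + hcollinear)

theorem HypPlane.comparisonHaversine_eq {K : Set.Iio (0 : ℝ)} {o m n x y : HypPlane K}
    (hmo : m ≠ o) (hno : n ≠ o) (hm : dist o m + dist m x = dist o x)
    (hn : dist o n + dist n y = dist o y) :
    comparisonHaversine (curvatureScale K) o m n =
      comparisonHaversine (curvatureScale K) o x y := by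
  rw [comparisonHaversine_eq_of_between hmo hm, comparisonHaversine_comm _ o x,
    comparisonHaversine_eq_of_between hno hn, comparisonHaversine_comm]

namespace IsCAT

variable {K : Set.Iio (0 : ℝ)}

local notation "κ" => curvatureScale K

theorem comparisonHaversine_le (hX : IsCAT K X) {o x y m n : X}
    (hm : dist o m + dist m x = dist o x) (hn : dist o n + dist n y = dist o y) :
    comparisonHaversine κ o m n ≤ comparisonHaversine κ o x y := by
  have hκ := curvatureScale_pos K
  rcases eq_or_ne m o with rfl | hmo
  · simpa [comparisonHaversine] using comparisonHaversine_nonneg hκ m x y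
  rcases eq_or_ne n o with rfl | hno
  · simpa [comparisonHaversine] using comparisonHaversine_nonneg hκ n x y
  obtain ⟨o', x', y', hox, hoy, hxy, hcat⟩ := hX.2 o x y
  obtain ⟨m', hom, hmx⟩ := o'.exists_dist_eq_dist_eq x' dist_nonneg dist_nonneg (hm.trans hox.symm)
  obtain ⟨n', hon, hny⟩ := o'.exists_dist_eq_dist_eq y' dist_nonneg dist_nonneg (hn.trans hoy.symm)
  have hmo' : m' ≠ o' := (dist_pos.mp (hom ▸ dist_pos.mpr hmo.symm)).symm
  have hno' : n' ≠ o' := (dist_pos.mp (hon ▸ dist_pos.mpr hno.symm)).symm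
  have hmn : dist m n ≤ dist m' n' := hcat m n m' n' hm hn hom hmx hon hny
  calc
    comparisonHaversine κ o m n ≤ comparisonHaversine κ o' m' n' := by
      rw [comparisonHaversine, comparisonHaversine, hom, hon]
      gcongr
      rw [cosh_le_cosh, abs_of_nonneg (by positivity), abs_of_nonneg (by positivity)]
      gcongr
    _ = comparisonHaversine κ o' x' y' :=
      HypPlane.comparisonHaversine_eq hmo' hno' (hom ▸ hmx ▸ hox ▸ hm) (hon ▸ hny ▸ hoy ▸ hn)
    _ = comparisonHaversine κ o x y := by
      rw [comparisonHaversine, comparisonHaversine, hox, hoy, hxy]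

theorem sinh_half_dist_le (hX : IsCAT K X) {o x y m n : X}
    (hm : dist o m + dist m x = dist o x) (hn : dist o n + dist n y = dist o y)
    (h : dist o m = dist o n) :
    sinh (κ * dist m n / 2) ≤ sinh (κ * dist o m) * exp (-(κ * gromovProduct o x y)) := by
  have hκ := curvatureScale_pos K
  refine le_of_sq_le_sq ?_ (by positivity)
  rw [sinh_half_dist_sq hκ h, mul_pow]
  gcongr
  exact (hX.comparisonHaversine_le hm hn).trans (comparisonHaversine_le_exp hκ o x y)

theorem dist_le_of_dist_eq (hX : IsCAT K X) {o x y m n : X}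
    (hm : dist o m + dist m x = dist o x) (hn : dist o n + dist n y = dist o y)
    (h : dist m x = dist n y) : dist m n ≤ dist x y := by
  have hκ := curvatureScale_pos K
  have hsub : dist o m - dist o n = dist o x - dist o y := by linarith
  have hcosh : cosh (κ * dist m n) ≤ cosh (κ * dist x y) := by
    rw [cosh_mul_dist_eq hκ o m n, cosh_mul_dist_eq hκ o x y, hsub]
    have hhav := comparisonHaversine_nonneg hκ o m n
    have hmx : dist o m ≤ dist o x := hm ▸ le_add_of_nonneg_right dist_nonneg
    have hny : dist o n ≤ dist o y := hn ▸ le_add_of_nonneg_right dist_nonneg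
    gcongr
    exacts [sinh_le_sinh.mpr (by gcongr), sinh_le_sinh.mpr (by gcongr),
      hX.comparisonHaversine_le hm hn]
  rw [cosh_le_cosh, abs_of_nonneg (by positivity), abs_of_nonneg (by positivity)] at hcosh
  exact le_of_mul_le_mul_left hcosh hκ

theorem dist_eq_add_of_dist_eq_add (hX : IsCAT K X) {o x y m n : X} (hmo : m ≠ o) (hno : n ≠ o)
    (hm : dist o m + dist m x = dist o x) (hn : dist o n + dist n y = dist o y)
    (h : dist m n = dist o m + dist o n) : dist x y = dist o x + dist o y := by
  have hκ := curvatureScale_pos K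
  have hom := dist_pos.mpr hmo.symm
  have hon := dist_pos.mpr hno.symm
  have hstraight (a b : ℝ) :
      cosh (κ * (a + b)) = cosh (κ * (a - b)) + 2 * sinh (κ * a) * sinh (κ * b) := by
    rw [mul_add, mul_sub, cosh_add, cosh_sub]
    ring
  -- The comparison angle at `o` is `π`.
  have hhav : comparisonHaversine κ o m n = 1 := by
    rw [comparisonHaversine, h, hstraight, add_sub_cancel_left, div_self (by positivity)]
  have hcosh : cosh (κ * (dist o x + dist o y)) ≤ cosh (κ * dist x y) := by
    rw [hstraight, cosh_mul_dist_eq hκ o x y]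
    have := hhav.symm.trans_le (hX.comparisonHaversine_le hm hn)
    exact add_le_add_right (le_mul_of_one_le_right (by positivity) this) _
  rw [cosh_le_cosh, abs_of_nonneg (by positivity), abs_of_nonneg (by positivity)] at hcosh
  exact le_antisymm (dist_triangle_left x y o) (le_of_mul_le_mul_left hcosh hκ)

end IsCAT

end Comparison

section Rays

variable {X : Type*} [MetricSpace X]

namespace GeodesicRay

theorem ext {f g : GeodesicRay X} (h : ∀ t, f t = g t) : f = g := by
  obtain ⟨f, hf⟩ := f
  obtain rfl : f = g := funext h
  rfl

theorem dist_eq (f : GeodesicRay X) (s t : ℝ≥0) : dist (f s) (f t) = |(s : ℝ) - t| :=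
  (f.isometry.dist_eq s t).trans (NNReal.dist_eq s t)

theorem dist_eq_sub (f : GeodesicRay X) {s t : ℝ≥0} (h : s ≤ t) : dist (f s) (f t) = t - s := by
  rw [dist_comm, f.dist_eq, abs_of_nonneg (sub_nonneg.mpr (NNReal.coe_le_coe.mpr h))]

theorem dist_zero (f : GeodesicRay X) (t : ℝ≥0) : dist (f 0) (f t) = t := by
  rw [f.dist_eq_sub zero_le, NNReal.coe_zero, sub_zero]

theorem dist_zero_add_dist (f : GeodesicRay X) {s t : ℝ≥0} (h : s ≤ t) :
    dist (f 0) (f s) + dist (f s) (f t) = dist (f 0) (f t) := by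
  rw [f.dist_zero, f.dist_zero, f.dist_eq_sub h, add_sub_cancel]

theorem endpoint_eq_iff {f g : GeodesicRay X} :
    f.endpoint = g.endpoint ↔ ∃ C : ℝ, ∀ t, dist (f t) (g t) ≤ C :=
  Quotient.eq

/-- The subray `t ↦ f (a + t)` of the ray `f`. -/
def shift (f : GeodesicRay X) (a : ℝ≥0) : GeodesicRay X where
  toFun t := f (a + t)
  isometry := f.isometry.comp (Isometry.of_dist_eq fun s t => by
    rw [NNReal.dist_eq, NNReal.dist_eq, NNReal.coe_add, NNReal.coe_add, add_sub_add_left_eq_sub])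

theorem shift_apply (f : GeodesicRay X) (a t : ℝ≥0) : f.shift a t = f (a + t) :=
  rfl

theorem endpoint_shift (f : GeodesicRay X) (a : ℝ≥0) : (f.shift a).endpoint = f.endpoint :=
  endpoint_eq_iff.mpr ⟨a, fun t => by rw [shift_apply, f.dist_eq]; simp⟩

variable {f g : GeodesicRay X}

theorem gromovProduct_eq (h : f 0 = g 0) (s t : ℝ≥0) :
    gromovProduct (f 0) (f s) (g t) = (s + t - dist (f s) (g t)) / 2 := by
  rw [gromovProduct, dist_comm _ (f 0), dist_comm _ (f 0), f.dist_zero, h, g.dist_zero]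

theorem gromovProduct_mono (h : f 0 = g 0) :
    Monotone fun r : ℝ≥0 × ℝ≥0 => gromovProduct (f 0) (f r.1) (g r.2) := by
  rintro ⟨s, t⟩ ⟨s', t'⟩ ⟨hs : s ≤ s', ht : t ≤ t'⟩
  have := dist_triangle4 (f s') (f s) (g t) (g t')
  rw [dist_comm _ (f s), f.dist_eq_sub hs, g.dist_eq_sub ht] at this
  simp only [gromovProduct_eq h]
  linarith

theorem rayGromovProduct_eq_iSup (h : f 0 = g 0) :
    rayGromovProduct f g =
      ⨆ r : ℝ≥0 × ℝ≥0, ((gromovProduct (f 0) (f r.1) (g r.2) : ℝ) : EReal) :=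
  (tendsto_atTop_iSup fun _ _ hr =>
    EReal.coe_le_coe_iff.mpr (gromovProduct_mono h hr)).liminf_eq

theorem coe_gromovProduct_le (h : f 0 = g 0) (s t : ℝ≥0) :
    ((gromovProduct (f 0) (f s) (g t) : ℝ) : EReal) ≤ rayGromovProduct f g := by
  rw [rayGromovProduct_eq_iSup h]
  exact le_iSup (fun r : ℝ≥0 × ℝ≥0 => ((gromovProduct (f 0) (f r.1) (g r.2) : ℝ) : EReal)) (s, t)

theorem rayGromovProduct_le_add {f' g' : GeodesicRay X} (h : f 0 = g 0) (h' : f' 0 = g' 0) {c : ℝ}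
    (hf : ∀ t, dist (f t) (f' t) ≤ c) (hg : ∀ t, dist (g t) (g' t) ≤ c) :
    rayGromovProduct f g ≤ rayGromovProduct f' g' + c := by
  rw [rayGromovProduct_eq_iSup h]
  refine iSup_le fun ⟨s, t⟩ => ?_
  calc
    ((gromovProduct (f 0) (f s) (g t) : ℝ) : EReal)
      ≤ ((gromovProduct (f' 0) (f' s) (g' t) + c : ℝ) : EReal) := by
      have := dist_triangle4_right (f' s) (g' t) (f s) (g t)
      have := hf s
      have := hg t
      rw [EReal.coe_le_coe_iff, gromovProduct_eq h, gromovProduct_eq h']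
      linarith [dist_comm (f' s) (f s), dist_comm (g' t) (g t)]
    _ ≤ rayGromovProduct f' g' + c := by
      rw [EReal.coe_add]
      exact add_le_add_left (coe_gromovProduct_le h' s t) _

theorem rayGromovProduct_eq_top (h : f 0 = g 0) (hfg : f.endpoint = g.endpoint) :
    rayGromovProduct f g = ⊤ := by
  obtain ⟨C, hC⟩ := endpoint_eq_iff.mp hfg
  refine EReal.eq_top_iff_forall_lt _ |>.mpr fun a => ?_
  set t : ℝ≥0 := (a + C).toNNReal + 1 with ht_def
  have ht : a + C < t := by
    rw [ht_def, NNReal.coe_add, NNReal.coe_one]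
    exact (Real.le_coe_toNNReal _).trans_lt (lt_add_one _)
  have hC' := hC t
  have hC0 : 0 ≤ C := dist_nonneg.trans hC'
  refine lt_of_lt_of_le (EReal.coe_lt_coe_iff.mpr ?_) (coe_gromovProduct_le h t t)
  rw [gromovProduct_eq h]
  linarith

end GeodesicRay

end Rays

section RaysInCAT

open Real

variable {X : Type*} [MetricSpace X] {K : Set.Iio (0 : ℝ)}

local notation "κ" => curvatureScale K

theorem IsCAT.sinh_half_dist_ray_le (hX : IsCAT K X) {f g : GeodesicRay X} (h : f 0 = g 0)
    (ℓ s t : ℝ≥0) :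
    sinh (κ * dist (f ℓ) (g ℓ) / 2) ≤
      sinh (κ * ℓ) * exp (-(κ * gromovProduct (f 0) (f s) (g t))) := by
  have hκ := curvatureScale_pos K
  have hle := hX.sinh_half_dist_le (f.dist_zero_add_dist (le_max_left ℓ s))
    (by rw [h]; exact g.dist_zero_add_dist (le_max_left ℓ t)) (by rw [f.dist_zero, h, g.dist_zero])
  rw [f.dist_zero] at hle
  have hmono : gromovProduct (f 0) (f s) (g t) ≤
      gromovProduct (f 0) (f (max ℓ s)) (g (max ℓ t)) :=
    GeodesicRay.gromovProduct_mono h (Prod.mk_le_mk.mpr ⟨le_max_right ℓ s, le_max_right ℓ t⟩)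
  exact hle.trans (by gcongr)

theorem IsCAT.eq_of_endpoint_eq (hX : IsCAT K X) {f g : GeodesicRay X} (h : f 0 = g 0)
    (hfg : f.endpoint = g.endpoint) : f = g := by
  have hκ := curvatureScale_pos K
  refine GeodesicRay.ext fun ℓ => ?_
  have htop := GeodesicRay.rayGromovProduct_eq_top h hfg
  have hle (n : ℕ) : sinh (κ * dist (f ℓ) (g ℓ) / 2) ≤ sinh (κ * ℓ) * exp (-(κ * n)) := by
    have hn : ((n : ℝ) : EReal) < rayGromovProduct f g := htop ▸ EReal.coe_lt_top _
    rw [GeodesicRay.rayGromovProduct_eq_iSup h, lt_iSup_iff] at hn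
    obtain ⟨⟨s, t⟩, hst⟩ := hn
    have hst := (EReal.coe_lt_coe_iff.mp hst).le
    exact (hX.sinh_half_dist_ray_le h ℓ s t).trans (by gcongr)
  have hlim : Tendsto (fun n : ℕ => sinh (κ * ℓ) * exp (-(κ * n))) atTop (𝓝 0) := by
    simpa only [mul_zero, Function.comp_def] using (tendsto_exp_neg_atTop_nhds_zero.comp
      (tendsto_natCast_atTop_atTop.const_mul_atTop hκ)).const_mul (sinh (κ * ℓ))
  have hnonpos := sinh_nonpos_iff.mp (ge_of_tendsto' hlim hle)
  refine dist_le_zero.mp (nonpos_of_mul_nonpos_right (a := κ) ?_ hκ)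
  linarith

theorem le_of_eventually_sinh_sub_le {a b : ℝ}
    (h : ∀ᶠ x in atTop, sinh (x - b) ≤ sinh x * exp (-a)) : a ≤ b := by
  have hlim : Tendsto (fun x => exp (-b) - exp (b - 2 * x)) atTop (𝓝 (exp (-b) - 0)) := by
    refine tendsto_const_nhds.sub (tendsto_exp_atBot.comp ?_)
    exact tendsto_atBot_add_const_left _ b
      (tendsto_neg_atTop_atBot.comp (tendsto_id.const_mul_atTop two_pos))
  have hle : exp (-b) - 0 ≤ exp (-a) := by
    refine le_of_tendsto hlim (h.mono fun x hx => ?_)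
    have hexp : sinh x * 2 ≤ exp x := by
      rw [sinh_eq]
      linarith [exp_pos (-x)]
    have hsinh : exp (-b) - exp (b - 2 * x) = sinh (x - b) * 2 * exp (-x) := by
      rw [sinh_eq, div_mul_cancel₀ _ two_ne_zero, sub_mul, ← exp_add, ← exp_add]
      ring_nf
    calc
      exp (-b) - exp (b - 2 * x) = sinh (x - b) * 2 * exp (-x) := hsinh
      _ ≤ exp x * exp (-a) * exp (-x) := by
        refine mul_le_mul_of_nonneg_right ?_ (exp_pos _).le
        nlinarith [exp_pos (-a)]
      _ = exp (-a) := by rw [mul_right_comm, ← exp_add, add_neg_cancel, exp_zero, one_mul]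
  rw [sub_zero, exp_le_exp] at hle
  linarith

theorem HypPlane.sinh_half_dist_ray_eq {f g : GeodesicRay (HypPlane K)} (h : f 0 = g 0)
    {s t : ℝ≥0} (hs : 0 < s) (hst : s ≤ t) :
    sinh (κ * t) * sinh (κ * dist (f s) (g s) / 2) =
      sinh (κ * s) * sinh (κ * dist (f t) (g t) / 2) := by
  have hκ := curvatureScale_pos K
  have hne (f : GeodesicRay (HypPlane K)) : f s ≠ f 0 := f.isometry.injective.ne hs.ne'
  have hhav := comparisonHaversine_eq (hne f) (h ▸ hne g) (f.dist_zero_add_dist hst)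
    (h ▸ g.dist_zero_add_dist hst)
  have hsq (r : ℝ≥0) : sinh (κ * dist (f r) (g r) / 2) ^ 2 =
      sinh (κ * r) ^ 2 * comparisonHaversine κ (f 0) (f r) (g r) := by
    rw [sinh_half_dist_sq hκ (by rw [f.dist_zero, h, g.dist_zero]), f.dist_zero]
  refine (pow_left_inj₀ (by positivity) (by positivity) two_ne_zero).mp ?_
  rw [mul_pow, mul_pow, hsq, hsq, hhav, mul_left_comm]

theorem HypPlane.le_rayGromovProduct {f g : GeodesicRay (HypPlane K)} (h : f 0 = g 0) {ℓ : ℝ≥0}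
    (hℓ : 0 < ℓ) {a : ℝ}
    (ha : sinh (κ * dist (f ℓ) (g ℓ) / 2) ≤ sinh (κ * ℓ) * exp (-(κ * a))) :
    (a : EReal) ≤ rayGromovProduct f g := by
  have hκ := curvatureScale_pos K
  by_contra! hlt
  obtain ⟨b, hb, hba⟩ := EReal.lt_iff_exists_real_btwn.mp hlt
  have hsinh : ∀ t ≥ ℓ, sinh (κ * t - κ * b) ≤ sinh (κ * t) * exp (-(κ * a)) := by
    intro t ht
    have hgp := EReal.coe_le_coe_iff.mp ((GeodesicRay.coe_gromovProduct_le h t t).trans hb.le)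
    rw [GeodesicRay.gromovProduct_eq h] at hgp
    have hdist : sinh (κ * t - κ * b) ≤ sinh (κ * dist (f t) (g t) / 2) := by
      rw [sinh_le_sinh, ← mul_sub, mul_div_assoc]
      gcongr
      linarith
    have hpos : 0 < sinh (κ * ℓ) := sinh_pos_iff.mpr (mul_pos hκ (NNReal.coe_pos.mpr hℓ))
    refine hdist.trans (le_of_mul_le_mul_left ?_ hpos)
    rw [← sinh_half_dist_ray_eq h hℓ ht, mul_left_comm]
    gcongr
  have hab : κ * a ≤ κ * b := le_of_eventually_sinh_sub_le (by
    filter_upwards [eventually_ge_atTop (κ * ℓ)] with x hx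
    have hx' : (ℓ : ℝ) ≤ x / κ := (le_div_iff₀' hκ).mpr hx
    lift x / κ to ℝ≥0 using ℓ.2.trans hx' with t ht
    rw [show x = κ * t by rw [ht, mul_div_cancel₀ _ hκ.ne']]
    exact hsinh t hx')
  exact (EReal.coe_lt_coe_iff.mp hba).not_ge (le_of_mul_le_mul_left hab hκ)

end RaysInCAT

section Lines

variable {X : Type*} [MetricSpace X]

namespace GeodesicLine

theorem dist_eq (γ : GeodesicLine X) (s t : ℝ) : dist (γ s) (γ t) = |s - t| :=
  (γ.isometry.dist_eq s t).trans (Real.dist_eq s t)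

/-- The ray `t ↦ γ (a - t)` from `γ a` to the backward endpoint of `γ`. -/
def backwardFrom (γ : GeodesicLine X) (a : ℝ) : GeodesicRay X where
  toFun t := γ (a - t)
  isometry := γ.isometry.comp (Isometry.of_dist_eq fun s t => by
    rw [dist_sub_left, NNReal.dist_eq, Real.dist_eq])

theorem backwardFrom_apply (γ : GeodesicLine X) (a : ℝ) (t : ℝ≥0) :
    γ.backwardFrom a t = γ (a - t) :=
  rfl

theorem dist_backwardFrom_backward (γ : GeodesicLine X) (a : ℝ) (t : ℝ≥0) :
    dist (γ.backwardFrom a t) (γ.backward t) = |a| := by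
  rw [backwardFrom_apply, backward, γ.dist_eq]
  simp

theorem endpoint_backwardFrom (γ : GeodesicLine X) (a : ℝ) :
    (γ.backwardFrom a).endpoint = γ.backward.endpoint :=
  GeodesicRay.endpoint_eq_iff.mpr ⟨|a|, fun t => (γ.dist_backwardFrom_backward a t).le⟩

theorem exists_forward_eq_backward_eq {f k : GeodesicRay X}
    (h : ∀ s t : ℝ≥0, dist (f s) (k t) = s + t) :
    ∃ γ : GeodesicLine X, γ.forward = f ∧ γ.backward = k := by
  have hzero : f 0 = k 0 := dist_eq_zero.mp (by simpa using h 0 0)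
  set c : ℝ → X := fun t => if 0 ≤ t then f t.toNNReal else k (-t).toNNReal with hc
  have hf (t : ℝ≥0) : c t = f t := by simp [hc]
  have hk (t : ℝ≥0) : c (-t) = k t := by
    rcases eq_zero_or_pos t with rfl | ht
    · simpa using (hf 0).trans hzero
    · simp [hc, (NNReal.coe_pos.mpr ht).not_ge]
  have hcases (x : ℝ) : ∃ t : ℝ≥0, x = t ∨ x = -t := by
    rcases le_total 0 x with hx | hx
    · exact ⟨⟨x, hx⟩, .inl rfl⟩
    · exact ⟨⟨-x, neg_nonneg.mpr hx⟩, .inr (neg_neg x).symm⟩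
  refine ⟨⟨c, Isometry.of_dist_eq fun x y => ?_⟩, GeodesicRay.ext hf, GeodesicRay.ext hk⟩
  have habs (s t : ℝ≥0) : |(s : ℝ) + t| = s + t := abs_of_nonneg (by positivity)
  obtain ⟨s, rfl | rfl⟩ := hcases x <;> obtain ⟨t, rfl | rfl⟩ := hcases y <;>
    simp only [hf, hk, Real.dist_eq]
  · exact f.dist_eq s t
  · rw [h, sub_neg_eq_add, habs]
  · rw [dist_comm, h, ← neg_add', abs_neg, habs, add_comm]
  · rw [k.dist_eq, neg_sub_neg, abs_sub_comm]

end GeodesicLine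

variable {K : Set.Iio (0 : ℝ)}

theorem IsCAT.exists_line_of_dist_eq (hX : IsCAT K X) {f k : GeodesicRay X} (h : f 0 = k 0)
    {ε : ℝ≥0} (hε : 0 < ε) (hfk : dist (f ε) (k ε) = ε + ε) :
    ∃ γ : GeodesicLine X, γ.forward = f ∧ γ.backward = k := by
  have hfar {s t : ℝ≥0} (hs : ε ≤ s) (ht : ε ≤ t) : dist (f s) (k t) = s + t := by
    rw [hX.dist_eq_add_of_dist_eq_add (f.isometry.injective.ne hε.ne')
      (h ▸ k.isometry.injective.ne hε.ne') (f.dist_zero_add_dist hs) (h ▸ k.dist_zero_add_dist ht)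
      (by rw [hfk, f.dist_zero, h, k.dist_zero]), f.dist_zero, h, k.dist_zero]
  refine GeodesicLine.exists_forward_eq_backward_eq fun s t => le_antisymm ?_ ?_
  · have := dist_triangle_left (f s) (k t) (f 0)
    rwa [f.dist_zero, h, k.dist_zero] at this
  · have := dist_triangle4 (f (max ε s)) (f s) (k t) (k (max ε t))
    rw [hfar (le_max_left ε s) (le_max_left ε t), dist_comm _ (f s),
      f.dist_eq_sub (le_max_right ε s), k.dist_eq_sub (le_max_right ε t)] at this
    linarith

theorem IsCAT.exists_forward_eq (hX : IsCAT K X) (hext : HasGeodesicExtension X)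
    (f : GeodesicRay X) : ∃ γ : GeodesicLine X, γ.forward = f := by
  obtain ⟨γ, hγ₀, hγ₁⟩ := hext (f 0) (f 1) (f.isometry.injective.ne zero_ne_one)
  rw [f.dist_zero, NNReal.coe_one] at hγ₁
  have hzero : f 0 = γ.backward 0 := by simp [GeodesicLine.backward, hγ₀]
  have hone : dist (f 1) (γ.backward 1) = (1 : ℝ≥0) + (1 : ℝ≥0) := by
    rw [← hγ₁, GeodesicLine.backward, γ.dist_eq]
    norm_num
  obtain ⟨γ', hγ', -⟩ := hX.exists_line_of_dist_eq hzero one_pos hone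
  exact ⟨γ', hγ'⟩

end Lines

section Segments

variable {X : Type*} [MetricSpace X]

/-- `c` restricts to a unit speed geodesic segment `[0, dist x y] → X` from `x` to `y`; its values
elsewhere are irrelevant. -/
def IsGeodesicSegment (x y : X) (c : ℝ → X) : Prop :=
  c 0 = x ∧ c (dist x y) = y ∧
    ∀ s ∈ Set.Icc 0 (dist x y), ∀ t ∈ Set.Icc 0 (dist x y), dist (c s) (c t) = |s - t|

namespace IsGeodesicSegment

variable {x y : X} {c : ℝ → X} {t : ℝ}

theorem dist_left (hc : IsGeodesicSegment x y c) (ht₀ : 0 ≤ t) (ht : t ≤ dist x y) :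
    dist x (c t) = t := by
  rw [← hc.1, hc.2.2 0 ⟨le_rfl, dist_nonneg⟩ t ⟨ht₀, ht⟩, zero_sub, abs_neg, abs_of_nonneg ht₀]

theorem dist_right (hc : IsGeodesicSegment x y c) (ht₀ : 0 ≤ t) (ht : t ≤ dist x y) :
    dist (c t) y = dist x y - t := by
  nth_rw 1 [← hc.2.1]
  rw [hc.2.2 t ⟨ht₀, ht⟩ _ ⟨dist_nonneg, le_rfl⟩, abs_sub_comm, abs_of_nonneg (sub_nonneg.mpr ht)]

theorem dist_add_dist (hc : IsGeodesicSegment x y c) (ht₀ : 0 ≤ t) (ht : t ≤ dist x y) :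
    dist x (c t) + dist (c t) y = dist x y := by
  rw [hc.dist_left ht₀ ht, hc.dist_right ht₀ ht, add_sub_cancel]

end IsGeodesicSegment

theorem GeodesicRay.natCast_sub_dist_le (f : GeodesicRay X) (b : X) (n : ℕ) :
    n - dist b (f 0) ≤ dist b (f n) := by
  have := dist_triangle_left (f 0) (f n) b
  rw [f.dist_zero, NNReal.coe_natCast] at this
  linarith

theorem GeodesicRay.tendsto_dist_natCast (f : GeodesicRay X) (b : X) :
    Tendsto (fun n : ℕ => dist b (f n)) atTop atTop :=
  tendsto_atTop_mono (f.natCast_sub_dist_le b)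
    (tendsto_atTop_add_const_right _ _ tendsto_natCast_atTop_atTop)

theorem GeodesicRay.tendsto_gromovProduct_natCast (f : GeodesicRay X) (b : X) :
    Tendsto (fun r : ℕ × ℕ => gromovProduct b (f r.1) (f r.2)) atTop atTop := by
  have hmin (m n : ℕ) : min (m : ℝ) n - dist b (f 0) ≤ gromovProduct b (f m) (f n) := by
    have hm := f.natCast_sub_dist_le b m
    have hn := f.natCast_sub_dist_le b n
    rw [gromovProduct, dist_comm _ b, dist_comm _ b, f.dist_eq, NNReal.coe_natCast,
      NNReal.coe_natCast]
    linarith [min_add_max (m : ℝ) n, max_sub_min_eq_abs' (m : ℝ) n]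
  refine tendsto_atTop.mpr fun a => ?_
  obtain ⟨N, hN⟩ := exists_nat_ge (a + dist b (f 0))
  filter_upwards [eventually_ge_atTop (N, N)] with r hr
  have hmin_le : (N : ℝ) ≤ min (r.1 : ℝ) r.2 :=
    le_min (Nat.cast_le.mpr hr.1) (Nat.cast_le.mpr hr.2)
  linarith [hmin r.1 r.2]

variable {K : Set.Iio (0 : ℝ)} {b : X} {x : ℕ → X} {c : ℕ → ℝ → X}

local notation "κ" => curvatureScale K

theorem IsCAT.cauchySeq_segment (hX : IsCAT K X) (hc : ∀ n, IsGeodesicSegment b (x n) (c n))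
    (hdist : Tendsto (fun n => dist b (x n)) atTop atTop)
    (hgp : Tendsto (fun r : ℕ × ℕ => gromovProduct b (x r.1) (x r.2)) atTop atTop)
    {t : ℝ} (ht : 0 ≤ t) : CauchySeq fun n => c n t := by
  have hκ := curvatureScale_pos K
  have hbound : ∀ᶠ r : ℕ × ℕ in atTop, dist (c r.1 t) (c r.2 t) ≤
      2 / κ * (Real.sinh (κ * t) * Real.exp (-(κ * gromovProduct b (x r.1) (x r.2)))) := by
    have hlong := hdist.eventually_ge_atTop t
    filter_upwards [prod_atTop_atTop_eq (α := ℕ) (β := ℕ) ▸ hlong.prod_mk hlong] with r ⟨h₁, h₂⟩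
    have hsinh := hX.sinh_half_dist_le ((hc r.1).dist_add_dist ht h₁)
      ((hc r.2).dist_add_dist ht h₂)
      (((hc r.1).dist_left ht h₁).trans ((hc r.2).dist_left ht h₂).symm)
    rw [(hc r.1).dist_left ht h₁] at hsinh
    have hself : κ * dist (c r.1 t) (c r.2 t) / 2 ≤ _ :=
      (Real.self_le_sinh_iff.mpr (by positivity)).trans hsinh
    calc
      dist (c r.1 t) (c r.2 t) = 2 / κ * (κ * dist (c r.1 t) (c r.2 t) / 2) := by field_simp
      _ ≤ _ := by gcongr
  have hlim : Tendsto (fun r : ℕ × ℕ =>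
      2 / κ * (Real.sinh (κ * t) * Real.exp (-(κ * gromovProduct b (x r.1) (x r.2)))))
      atTop (𝓝 0) := by
    simpa only [mul_zero, Function.comp_def] using
      ((Real.tendsto_exp_neg_atTop_nhds_zero.comp (hgp.const_mul_atTop hκ)).const_mul
        (Real.sinh (κ * t))).const_mul (2 / κ)
  exact cauchySeq_iff_tendsto_dist_atTop_0.mpr
    (squeeze_zero' (.of_forall fun _ => dist_nonneg) hbound hlim)

theorem IsCAT.exists_ray_tendsto_segment [CompleteSpace X] (hX : IsCAT K X)
    (hc : ∀ n, IsGeodesicSegment b (x n) (c n))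
    (hdist : Tendsto (fun n => dist b (x n)) atTop atTop)
    (hgp : Tendsto (fun r : ℕ × ℕ => gromovProduct b (x r.1) (x r.2)) atTop atTop) :
    ∃ h : GeodesicRay X, ∀ t : ℝ≥0, Tendsto (fun n => c n t) atTop (𝓝 (h t)) := by
  choose h hh using fun t : ℝ≥0 =>
    cauchySeq_tendsto_of_complete (hX.cauchySeq_segment hc hdist hgp t.coe_nonneg)
  refine ⟨⟨h, Isometry.of_dist_eq fun s t => tendsto_nhds_unique ((hh s).dist (hh t)) ?_⟩, hh⟩
  refine tendsto_const_nhds.congr' ?_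
  filter_upwards [hdist.eventually_ge_atTop s, hdist.eventually_ge_atTop t] with n hs ht
  exact (NNReal.dist_eq s t).trans ((hc n).2.2 s ⟨s.coe_nonneg, hs⟩ t ⟨t.coe_nonneg, ht⟩).symm

theorem IsCAT.exists_ray_dist_le [CompleteSpace X] (hX : IsCAT K X) (b : X) (f : GeodesicRay X) :
    ∃ h : GeodesicRay X, h 0 = b ∧ ∀ t, dist (h t) (f t) ≤ dist b (f 0) := by
  choose c hc using fun n : ℕ => hX.1 b (f n)
  have hseg (n : ℕ) : IsGeodesicSegment b (f n) (c n) := hc n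
  have hdist := f.tendsto_dist_natCast b
  obtain ⟨h, hh⟩ := hX.exists_ray_tendsto_segment hseg hdist (f.tendsto_gromovProduct_natCast b)
  refine ⟨h, tendsto_nhds_unique (hh 0) ?_, fun t => ?_⟩
  · simp only [NNReal.coe_zero, (hseg _).1, tendsto_const_nhds]
  · refine le_of_tendsto ((hh t).dist tendsto_const_nhds) ?_
    filter_upwards [hdist.eventually_ge_atTop t,
      (tendsto_natCast_atTop_atTop (R := ℝ≥0)).eventually_ge_atTop t] with n hlong hn
    refine hX.dist_le_of_dist_eq (o := f n) ?_ ?_ ?_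
    · have := (hseg n).dist_add_dist t.coe_nonneg hlong
      rwa [add_comm, dist_comm b, dist_comm _ (f n), dist_comm b] at this
    · have := f.dist_zero_add_dist hn
      rwa [add_comm, dist_comm (f 0), dist_comm _ (f n), dist_comm (f 0)] at this
    · rw [dist_comm (c n t), (hseg n).dist_left t.coe_nonneg hlong, dist_comm (f t), f.dist_zero]

theorem IsCAT.dist_le_of_endpoint_eq [CompleteSpace X] (hX : IsCAT K X) {f g : GeodesicRay X}
    (h : f.endpoint = g.endpoint) (t : ℝ≥0) : dist (f t) (g t) ≤ dist (f 0) (g 0) := by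
  obtain ⟨f', hzero, hle⟩ := hX.exists_ray_dist_le (f 0) g
  obtain rfl : f' = f :=
    hX.eq_of_endpoint_eq hzero ((GeodesicRay.endpoint_eq_iff.mpr ⟨_, hle⟩).trans h.symm)
  exact hle t

end Segments

theorem ActsCocompactly.completeSpace {G X : Type*} [Group G] [MetricSpace X]
    [LocallyCompactSpace X] [MulAction G X] [IsIsometricSMul G X] (hG : ActsCocompactly G X) :
    CompleteSpace X := by
  obtain ⟨C, hC, hcover⟩ := hG
  obtain ⟨δ, hδ, hthick⟩ := hC.exists_isCompact_cthickening
  have hball (x : X) : IsCompact (Metric.closedBall x δ) := by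
    obtain ⟨g, y, hy, rfl⟩ := hcover x
    have hy' : IsCompact (Metric.closedBall y δ) :=
      hthick.of_isClosed_subset Metric.isClosed_closedBall
        (Metric.closedBall_subset_cthickening hy δ)
    rw [← Metric.smul_closedBall]
    exact hy'.smul g
  refine Metric.complete_of_cauchySeq_tendsto fun u hu => ?_
  obtain ⟨N, hN⟩ := Metric.cauchySeq_iff'.mp hu δ hδ
  obtain ⟨a, -, ha⟩ := cauchySeq_tendsto_of_isComplete (hball (u N)).isComplete
    (fun n => Metric.mem_closedBall.mpr (hN (n + N) le_add_self).le) (cauchySeq_shift N |>.mpr hu)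
  exact ⟨a, (tendsto_add_atTop_iff_nat N).mp ha⟩

section HyperbolicSine

open Real

theorem convexOn_sinh : ConvexOn ℝ (Set.Ici 0) sinh := by
  refine MonotoneOn.convexOn_of_deriv (convex_Ici 0) continuous_sinh.continuousOn
    differentiable_sinh.differentiableOn ?_
  rw [Real.deriv_sinh, interior_Ici]
  intro x hx y hy hxy
  rwa [cosh_le_cosh, abs_of_pos hx, abs_of_pos hy]

theorem sinh_mul_le_mul_sinh {q x : ℝ} (hq₀ : 0 ≤ q) (hq₁ : q ≤ 1) (hx : 0 ≤ x) :
    sinh (q * x) ≤ q * sinh x := by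
  simpa using convexOn_sinh.2 hx (Set.mem_Ici.mpr le_rfl) hq₀ (sub_nonneg.mpr hq₁)
    (add_sub_cancel q 1)

theorem le_mul_sinh_div_of_sinh_le {a q d ℓ : ℝ} (ha : 0 < a) (hq : 0 ≤ q) (hℓ₀ : 0 ≤ ℓ)
    (hℓ₁ : ℓ ≤ 1) (hd : 0 ≤ d) (h : sinh (a * d) ≤ sinh (a * ℓ) * q) :
    d ≤ ℓ * q * (sinh a / a) := by
  rw [← mul_div_assoc, le_div_iff₀ ha]
  calc
    d * a = a * d := mul_comm d a
    _ ≤ sinh (a * d) := self_le_sinh_iff.mpr (by positivity)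
    _ ≤ sinh (a * ℓ) * q := h
    _ ≤ ℓ * sinh a * q := by
      gcongr
      rw [mul_comm]
      exact sinh_mul_le_mul_sinh hℓ₀ hℓ₁ ha.le
    _ = ℓ * q * sinh a := by ring

theorem exists_sinh_le_sinh_mul_exp {a b : ℝ} (ha : 0 < a) (hb : 0 < b) :
    ∃ C : ℝ, 0 ≤ C ∧ ∀ A ℓ d : ℝ, 0 ≤ A → 0 ≤ ℓ → ℓ ≤ 1 → 0 ≤ d →
      sinh (a * d) ≤ sinh (a * ℓ) * exp (-(a * A)) →
      sinh (b * d) ≤ sinh (b * ℓ) * exp (-(b * (a / b * A - C))) := by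
  set M := sinh a / a
  set N := sinh (b * M) / b
  have hM : 1 ≤ M := (one_le_div ha).mpr (self_le_sinh_iff.mpr ha.le)
  have hN : 1 ≤ N := by
    rw [one_le_div hb]
    exact (le_mul_of_one_le_right hb.le hM).trans (self_le_sinh_iff.mpr (by positivity))
  refine ⟨log N / b, div_nonneg (log_nonneg hN) hb.le, fun A ℓ d hA hℓ₀ hℓ₁ hd h => ?_⟩
  set q := exp (-(a * A))
  have hq : q ≤ 1 := exp_le_one_iff.mpr (neg_nonpos.mpr (by positivity))
  have hexp : exp (-(b * (a / b * A - log N / b))) = q * N := by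
    rw [show -(b * (a / b * A - log N / b)) = -(a * A) + log N by field_simp; ring, exp_add,
      exp_log (zero_lt_one.trans_le hN)]
  calc
    sinh (b * d) ≤ sinh (b * (ℓ * q * M)) := by
      rw [sinh_le_sinh]
      gcongr
      exact le_mul_sinh_div_of_sinh_le ha (exp_nonneg _) hℓ₀ hℓ₁ hd h
    _ = sinh (ℓ * q * (b * M)) := by rw [mul_left_comm]
    _ ≤ ℓ * q * sinh (b * M) :=
      sinh_mul_le_mul_sinh (by positivity) (mul_le_one₀ hℓ₁ (by positivity) hq) (by positivity)
    _ = b * ℓ * (q * N) := by simp only [N]; field_simp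
    _ ≤ sinh (b * ℓ) * (q * N) := by
      gcongr
      exact self_le_sinh_iff.mpr (by positivity)
    _ = _ := by rw [hexp]

end HyperbolicSine

section BoundedFlip

variable {X : Type*} [MetricSpace X] {K₀ K : Set.Iio (0 : ℝ)} {f g h : GeodesicRay X}

theorem GeodesicRay.exists_not_shareInitialSegment_shift (h₀ : f 0 = g 0) (h₁ : f 1 ≠ g 1) :
    ∃ u < (1 : ℝ≥0), f u = g u ∧ ¬ShareInitialSegment (f.shift u) (g.shift u) := by
  have hclosed : IsClosed {u | f u = g u} :=
    isClosed_eq f.isometry.continuous g.isometry.continuous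
  obtain ⟨u, ⟨⟨-, hu₁⟩, hu⟩, hmax⟩ := ((isCompact_Icc (a := (0 : ℝ≥0)) (b := 1)).inter_right
    hclosed).exists_isGreatest ⟨0, ⟨le_rfl, zero_le_one⟩, h₀⟩
  have hlt : u < 1 := hu₁.lt_of_ne (by rintro rfl; exact h₁ hu)
  refine ⟨u, hlt, hu, fun ⟨ε, hε, hshare⟩ => ?_⟩
  have hstep : 0 < min ε (1 - u) := lt_min hε (tsub_pos_of_lt hlt)
  have hmem : u + min ε (1 - u) ≤ 1 :=
    (add_le_add_right (min_le_right _ _) u).trans_eq (add_tsub_cancel_of_le hu₁)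
  exact (lt_add_of_pos_right u hstep).not_ge
    (hmax ⟨⟨zero_le, hmem⟩, hshare _ (min_le_left _ _)⟩)

theorem GeodesicRay.mul_rayGromovProduct_le_add (hfg : f 0 = g 0) {R C : ℝ} (hR : 0 < R)
    {r : EReal} (h : ∀ s t, ((R * gromovProduct (f 0) (f s) (g t) - C : ℝ) : EReal) ≤ r) :
    (R : EReal) * rayGromovProduct f g ≤ r + C := by
  have hR' : (0 : EReal) < R := EReal.coe_pos.mpr hR
  rw [mul_comm, ← EReal.le_div_iff_mul_le hR' (EReal.coe_ne_top R), rayGromovProduct_eq_iSup hfg]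
  refine iSup_le fun st => ?_
  rw [EReal.le_div_iff_mul_le hR' (EReal.coe_ne_top R), mul_comm, ← EReal.coe_mul]
  calc
    _ = ((R * gromovProduct (f 0) (f st.1) (g st.2) - C : ℝ) : EReal) + C := by
      rw [← EReal.coe_add, sub_add_cancel]
    _ ≤ r + C := by gcongr; exact h st.1 st.2

theorem FatterThanComparison.le_rayGromovProduct (hfat : FatterThanComparison K f g)
    {ℓ : ℝ≥0} (hℓ : 0 < ℓ) {a : ℝ}
    (ha : Real.sinh (curvatureScale K * dist (f ℓ) (g ℓ) / 2) ≤
      Real.sinh (curvatureScale K * ℓ) * Real.exp (-(curvatureScale K * a))) :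
    (a : EReal) ≤ rayGromovProduct f g := by
  obtain ⟨f', g', hzero, hprod, hdist⟩ := hfat
  rw [← hprod]
  refine HypPlane.le_rayGromovProduct hzero hℓ (le_trans ?_ ha)
  rw [Real.sinh_le_sinh]
  have hκ := curvatureScale_pos K
  gcongr
  exact hdist ℓ ℓ

theorem GeodesicLine.backwardFrom_shift (γ : GeodesicLine X) (a : ℝ) (t : ℝ≥0) :
    (γ.backwardFrom a).shift t = γ.backwardFrom (a - t) :=
  GeodesicRay.ext fun s => by
    simp only [GeodesicRay.shift_apply, backwardFrom_apply, NNReal.coe_add, sub_sub]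

variable [CompleteSpace X]

theorem IsCAT.exists_line_or_exists_not_shareInitialSegment (hX : IsCAT K X)
    (γ : GeodesicLine X) (f : GeodesicRay X) :
    (∃ γ' : GeodesicLine X, γ'.forward = γ.forward ∧ γ'.backward.endpoint = f.endpoint) ∨
      ∃ (ℓ : ℝ≥0) (h : GeodesicRay X), 0 < ℓ ∧ ℓ ≤ 1 ∧ h 0 = γ ℓ ∧ h.endpoint = f.endpoint ∧
        ¬ShareInitialSegment h (γ.backwardFrom ℓ) := by
  obtain ⟨h, hzero, hasymp⟩ := hX.exists_ray_dist_le (γ 1) f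
  have hend : h.endpoint = f.endpoint := GeodesicRay.endpoint_eq_iff.mpr ⟨_, hasymp⟩
  have hstart : h 0 = γ.backwardFrom 1 0 := by simp [hzero, GeodesicLine.backwardFrom_apply]
  by_cases hone : h 1 = γ.backwardFrom 1 1
  · -- `h` passes through `γ 0`, and beyond it runs opposite to `γ.forward`.
    left
    have hfork : γ.forward 0 = h.shift 1 0 := by
      simp [GeodesicRay.shift_apply, hone, GeodesicLine.backwardFrom_apply, GeodesicLine.forward]
    have hopposite : dist (γ.forward 1) (h.shift 1 1) = (1 : ℝ≥0) + (1 : ℝ≥0) := by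
      have hforward : γ.forward 1 = h 0 := by simp [hzero, GeodesicLine.forward]
      rw [hforward, GeodesicRay.shift_apply, h.dist_zero, NNReal.coe_add]
    obtain ⟨γ', hγ', hback⟩ := hX.exists_line_of_dist_eq hfork one_pos hopposite
    exact ⟨γ', hγ', by rw [hback, h.endpoint_shift, hend]⟩
  · right
    obtain ⟨u, hu, hsplit, hshare⟩ :=
      GeodesicRay.exists_not_shareInitialSegment_shift hstart hone
    have hcoe : ((1 - u : ℝ≥0) : ℝ) = 1 - u := by rw [NNReal.coe_sub hu.le, NNReal.coe_one]
    rw [γ.backwardFrom_shift, ← hcoe] at hshare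
    refine ⟨1 - u, h.shift u, tsub_pos_of_lt hu, tsub_le_self, ?_,
      (h.endpoint_shift u).trans hend, hshare⟩
    rw [h.shift_apply, add_zero, hsplit, γ.backwardFrom_apply, hcoe]

variable {γ₁ γ₂ : GeodesicLine X} {ℓ : ℝ≥0}

theorem IsCAT.dist_backwardFrom_le (hX : IsCAT K X) (hγ : γ₁ 0 = γ₂ 0) (hstart : h 0 = γ₂ ℓ)
    (hend : h.endpoint = γ₁.backward.endpoint) :
    dist (h ℓ) (γ₂.backwardFrom ℓ ℓ) ≤ dist (γ₁ ℓ) (γ₂ ℓ) := by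
  have := hX.dist_le_of_endpoint_eq (hend.trans (γ₁.endpoint_backwardFrom ℓ).symm) ℓ
  rwa [hstart, γ₁.backwardFrom_apply, γ₁.backwardFrom_apply, sub_self, hγ, NNReal.coe_zero,
    sub_zero, dist_comm (γ₂ ℓ), ← sub_self (ℓ : ℝ), ← γ₂.backwardFrom_apply] at this

theorem IsCAT.rayGromovProduct_backwardFrom_le (hX : IsCAT K X) (hγ : γ₁ 0 = γ₂ 0)
    (hstart : h 0 = γ₂ ℓ) (hend : h.endpoint = γ₁.backward.endpoint) :
    rayGromovProduct h (γ₂.backwardFrom ℓ) ≤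
      rayGromovProduct γ₁.backward γ₂.backward + (ℓ : ℝ) := by
  have hbase : γ₁.backward 0 = γ₂.backward 0 := by simpa [GeodesicLine.backward] using hγ
  refine GeodesicRay.rayGromovProduct_le_add (by simp [hstart, GeodesicLine.backwardFrom_apply])
    hbase (fun t => (hX.dist_le_of_endpoint_eq hend t).trans_eq ?_)
    fun t => (γ₂.dist_backwardFrom_backward ℓ t).trans_le (abs_of_nonneg ℓ.coe_nonneg).le
  rw [hbase, hstart, GeodesicLine.backward, γ₂.dist_eq]
  simp

theorem IsCAT.exists_mul_rayGromovProduct_le_of_fatterThanComparison (hX : IsCAT K₀ X)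
    (K : Set.Iio (0 : ℝ)) :
    ∃ C : ℝ, 0 ≤ C ∧ ∀ (γ₁ γ₂ : GeodesicLine X) (ℓ : ℝ≥0) (h : GeodesicRay X), γ₁ 0 = γ₂ 0 →
      0 < ℓ → ℓ ≤ 1 → h 0 = γ₂ ℓ → h.endpoint = γ₁.backward.endpoint →
      FatterThanComparison K h (γ₂.backwardFrom ℓ) →
      ((curvatureScale K₀ / curvatureScale K : ℝ) : EReal) *
        rayGromovProduct γ₁.forward γ₂.forward ≤
        rayGromovProduct h (γ₂.backwardFrom ℓ) + C := by
  have hκ₀ := curvatureScale_pos K₀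
  have hκ := curvatureScale_pos K
  obtain ⟨C, hC, htransfer⟩ := exists_sinh_le_sinh_mul_exp hκ₀ hκ
  refine ⟨C, hC, fun γ₁ γ₂ ℓ h hγ hℓ₀ hℓ₁ hstart hend hfat => ?_⟩
  have hbase : γ₁.forward 0 = γ₂.forward 0 := hγ
  refine GeodesicRay.mul_rayGromovProduct_le_add hbase (div_pos hκ₀ hκ) fun s t =>
    hfat.le_rayGromovProduct hℓ₀ ?_
  have hvisual := hX.sinh_half_dist_ray_le hbase ℓ s t
  have hback := hX.dist_backwardFrom_le hγ hstart hend
  rw [mul_div_assoc]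
  refine htransfer _ ℓ _ (gromovProduct_nonneg _ _ _) ℓ.coe_nonneg hℓ₁
    (by positivity) (le_trans ?_ hvisual)
  rw [← mul_div_assoc, Real.sinh_le_sinh]
  gcongr
  exact hback

theorem IsCAT.exists_mul_rayGromovProduct_forward_le (hX : IsCAT K₀ X) (K : Set.Iio (0 : ℝ)) :
    ∃ C : ℝ, 0 < C ∧ ∀ (γ₁ γ₂ : GeodesicLine X) (ℓ : ℝ≥0) (h : GeodesicRay X), γ₁ 0 = γ₂ 0 →
      0 < ℓ → ℓ ≤ 1 → h 0 = γ₂ ℓ → h.endpoint = γ₁.backward.endpoint →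
      (h.endpoint ≠ γ₂.backward.endpoint → FatterThanComparison K h (γ₂.backwardFrom ℓ)) →
      ((curvatureScale K₀ / curvatureScale K : ℝ) : EReal) *
        rayGromovProduct γ₁.forward γ₂.forward ≤
        rayGromovProduct γ₁.backward γ₂.backward + C := by
  obtain ⟨C, hC, hfat_le⟩ := hX.exists_mul_rayGromovProduct_le_of_fatterThanComparison K
  refine ⟨C + 1, by positivity, fun γ₁ γ₂ ℓ h hγ hℓ₀ hℓ₁ hstart hend hfat => ?_⟩
  by_cases hne : h.endpoint = γ₂.backward.endpoint
  · have hbase : γ₁.backward 0 = γ₂.backward 0 := by simpa [GeodesicLine.backward] using hγ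
    rw [GeodesicRay.rayGromovProduct_eq_top hbase (hend.symm.trans hne), EReal.top_add_coe]
    exact le_top
  calc
    _ ≤ rayGromovProduct h (γ₂.backwardFrom ℓ) + C :=
      hfat_le γ₁ γ₂ ℓ h hγ hℓ₀ hℓ₁ hstart hend (hfat hne)
    _ ≤ rayGromovProduct γ₁.backward γ₂.backward + (ℓ : ℝ) + C := by
      gcongr
      exact hX.rayGromovProduct_backwardFrom_le hγ hstart hend
    _ = rayGromovProduct γ₁.backward γ₂.backward + (C + ℓ : ℝ) := by
      rw [add_assoc, ← EReal.coe_add, add_comm C]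
    _ ≤ rayGromovProduct γ₁.backward γ₂.backward + (C + 1 : ℝ) := by
      gcongr
      exact_mod_cast hℓ₁

theorem IsCAT.exists_line_through (hX : IsCAT K X) (hext : HasGeodesicExtension X)
    (ξ : IdealBoundary X) (p : X) : ∃ γ : GeodesicLine X, γ.forward.endpoint = ξ ∧ γ 0 = p := by
  obtain ⟨f, rfl⟩ := Quotient.exists_rep ξ
  obtain ⟨h, rfl, hasymp⟩ := hX.exists_ray_dist_le p f
  obtain ⟨γ, rfl⟩ := hX.exists_forward_eq hext h
  exact ⟨γ, GeodesicRay.endpoint_eq_iff.mpr ⟨_, hasymp⟩, rfl⟩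

end BoundedFlip

theorem mainTheorem7_general {X : Type*} [MetricSpace X] [CompleteSpace X]
    {K₀ K : Set.Iio (0 : ℝ)} (hX : IsCAT K₀ X) (hext : HasGeodesicExtension X)
    (htri : ∀ f g : GeodesicRay X, f 0 = g 0 → f.endpoint ≠ g.endpoint →
      ShareInitialSegment f g ∨ FatterThanComparison K f g) :
    HasBoundedFlip X := by
  obtain ⟨C, hC, hflip⟩ := hX.exists_mul_rayGromovProduct_forward_le K
  refine ⟨curvatureScale K₀ / curvatureScale K, C,
    div_pos (curvatureScale_pos K₀) (curvatureScale_pos K), hC, fun ζ ν p => ?_⟩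
  obtain ⟨γ₁, hζ, hp₁⟩ := hX.exists_line_through hext ζ p
  obtain ⟨γ₂, hν, hp₂⟩ := hX.exists_line_through hext ν p
  have hγ : γ₁ 0 = γ₂ 0 := hp₁.trans hp₂.symm
  rcases hX.exists_line_or_exists_not_shareInitialSegment γ₂ γ₁.backward with
    ⟨γ, hforward, hbackward⟩ | ⟨ℓ, h, hℓ₀, hℓ₁, hstart, hend, hshare⟩
  · have hp : γ 0 = p := (congrArg (fun f : GeodesicRay X => f 0) hforward).trans hp₂
    have hbase : γ₁.backward 0 = γ.backward 0 := by simp [GeodesicLine.backward, hp₁, hp]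
    refine ⟨γ₁, γ, hζ, hforward ▸ hν, hp₁, hp, ?_⟩
    rw [GeodesicRay.rayGromovProduct_eq_top hbase hbackward.symm]
    exact le_top
  · have hfat (hne : h.endpoint ≠ γ₂.backward.endpoint) :
        FatterThanComparison K h (γ₂.backwardFrom ℓ) :=
      (htri _ _ (by simp [hstart, GeodesicLine.backwardFrom_apply])
        (by rwa [γ₂.endpoint_backwardFrom])).resolve_left hshare
    exact ⟨γ₁, γ₂, hζ, hν, hp₁, hp₂,
      EReal.sub_le_of_le_add (hflip γ₁ γ₂ ℓ h hγ hℓ₀ hℓ₁ hstart hend hfat)⟩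

theorem mainTheorem7 {H : Type*} [MetricSpace H] [LocallyCompactSpace H]
    (hCAT : IsCATNegOne H) (hext : HasGeodesicExtension H)
    {G : Type*} [Group G] [MulAction G H] [IsIsometricSMul G H]
    (hG : ActsCocompactly G H)
    (K : ℝ) (hK : K < -1)
    (htri : ∀ f g : GeodesicRay H, f 0 = g 0 → f.endpoint ≠ g.endpoint →
      ShareInitialSegment f g ∨
        FatterThanComparison ⟨K, hK.trans (by norm_num)⟩ f g) :
    HasBoundedFlip H := by
  have := hG.completeSpace
  exact mainTheorem7_general hCAT hext htri
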